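/- Let $X$ be a standard Borel space and let $k \geq 1$ be an integer, identified with the set $\{0,1,\ldots,k-1\}$. An $(X,k)$-constraint $B$ with finite domain $\mathrm{dom}(B) = D \subseteq X$ is a set $B \subseteq k^{D}$ of functions $D \to k$; a function $f \colon X \to k$ violates $B$ if $f|_{D} \in B$. A constraint satisfaction problem (CSP) $\mathscr{B} \colon X \to^? k$ is a set of $(X,k)$-constraints, and a solution to $\mathscr{B}$ is a function $f \colon X \to k$ that violates no $B \in \mathscr{B}$. Put $$\mathsf{p}(\mathscr{B}) = \sup_{B \in \mathscr{B}} \frac{|B|}{k^{|\mathrm{dom}(B)|}}, \qquad \mathsf{vdeg}(\mathscr{B}) = \sup_{x \in X} |\{B \in \mathscr{B} : x \in \mathrm{dom}(B)\}|, \qquad \mathsf{ord}(\mathscr{B}) = \sup_{B \in \mathscr{B}} |\mathrm{dom}(B)|,$$ where $\mathsf{vdeg}(\mathscr{B}), \mathsf{ord}(\mathscr{B}) \in \mathbb{N} \cup \{\infty\}$, the supremum of the empty set is $0$, and we use the conventions $0^0 = 1$, $1^\infty = 1$, and $0 \cdot \infty = 0$. For a measurable space $Y$, let $[Y]^{<\infty}$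 be the set of all finite subsets of $Y$, where $A \subseteq [Y]^{<\infty}$ is Borel if for every $n \in \mathbb{N}$ the set $\{(y_1,\ldots,y_n) \in Y^n : \{y_1,\ldots,y_n\} \in A\}$ is measurable in $Y^n$. Identifying functions with their graphs, every $(X,k)$-constraint is a finite subset of $[X \times k]^{<\infty}$; the CSP $\mathscr{B}$ is Borel if it is a Borel subset of $[[X \times k]^{<\infty}]^{<\infty}$. If $\mathscr{B} \colon X \to^? k$ is a Borel CSP on the standard Borel space $X$ such that $$\mathsf{p}(\mathscr{B}) \cdot \mathsf{vdeg}(\mathscr{B})^{\mathsf{ord}(\mathscr{B})} < 1,$$ then $\mathscr{B}$ has a Borel solution $f \colon X \to k$. -/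

import Mathlib

open scoped ENNReal MeasureTheory

/-- The natural Borel structure on the set of finite subsets of `α`: the quotient structure
induced by the maps `(x₁, …, xₙ) ↦ {x₁, …, xₙ}` from the spaces `αⁿ`, `n ∈ ℕ`. A set `A` of finite
subsets is Borel if and only if `{(x₁, …, xₙ) | {x₁, …, xₙ} ∈ A}` is Borel in `αⁿ` for every `n`.
(Mathlib's instance on `Finset α` is generated by the events `a ∈ F` for single points `a` only,
which is too coarse when `α` is uncountable, so it is not used.) -/
@[reducible]
noncomputable def finsetBorel (α : Type*) (m : MeasurableSpace α) : MeasurableSpace (Finset α) :=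
  open scoped Classical in
  ⨅ n : ℕ, MeasurableSpace.map (fun x : Fin n → α => Finset.univ.image x)
    (@MeasurableSpace.pi (Fin n) (fun _ => α) fun _ => m)

/-- An `(X, k)`-constraint: a finite domain `D ⊆ X` with a set `B ⊆ k^D` of `k`-colorings of `D`
(the forbidden patterns). -/
structure Constraint (X : Type*) (k : ℕ) where
  dom : Finset X
  patterns : Finset (dom → Fin k)

namespace Constraint

variable {X : Type*} {k : ℕ}

/-- `f` violates `B` if the restriction of `f` to the domain of `B` is in `B`. -/
def Violates (f : X → Fin k) (B : Constraint X k) : Prop :=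
  (fun x : B.dom => f x) ∈ B.patterns

/-- `P[B] = |B| / k^|dom(B)|`. -/
noncomputable def prob (B : Constraint X k) : ℝ≥0∞ :=
  (B.patterns.card : ℝ≥0∞) / (k : ℝ≥0∞) ^ B.dom.card

/-- A `k`-coloring of a finite set `D`, viewed as a finite subset of `X × k` (its graph). -/
noncomputable def graph {D : Finset X} (φ : D → Fin k) : Finset (X × Fin k) :=
  open scoped Classical in
  Finset.univ.image fun x : D => ((x : X), φ x)

/-- A constraint viewed as a finite set of finite subsets of `X × k`. -/
noncomputable def code (B : Constraint X k) : Finset (Finset (X × Fin k)) :=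
  open scoped Classical in
  B.patterns.image graph

end Constraint

/-- A constraint satisfaction problem on `X` with range `k`: a set of `(X, k)`-constraints. -/
abbrev CSP (X : Type*) (k : ℕ) := Set (Constraint X k)

namespace CSP

variable {X : Type*} {k : ℕ}

/-- `p(𝓑) = sup_{B ∈ 𝓑} P[B]`. -/
noncomputable def p (𝓑 : CSP X k) : ℝ≥0∞ := ⨆ B ∈ 𝓑, B.prob

/-- The maximum vertex-degree `sup_{x ∈ X} |{B ∈ 𝓑 : x ∈ dom(B)}|`, possibly infinite. -/
noncomputable def vdeg (𝓑 : CSP X k) : ℕ∞ := ⨆ x : X, Set.encard {B ∈ 𝓑 | x ∈ B.dom}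

/-- The order `sup_{B ∈ 𝓑} |dom(B)|`, possibly infinite. -/
noncomputable def ord (𝓑 : CSP X k) : ℕ∞ := ⨆ B ∈ 𝓑, (B.dom.card : ℕ∞)

/-- A solution is a `k`-coloring of `X` that violates no constraint. -/
def IsSolution (𝓑 : CSP X k) (f : X → Fin k) : Prop := ∀ B ∈ 𝓑, ¬ B.Violates f

/-- A CSP is Borel if it is a Borel subset of the space of finite sets of finite subsets
of `X × k`. -/
def IsBorel [MeasurableSpace X] (𝓑 : CSP X k) : Prop :=
  MeasurableSet[finsetBorel (Finset (X × Fin k)) (finsetBorel (X × Fin k) inferInstance)]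
    (Constraint.code '' 𝓑)

end CSP

/-!
Points of a common domain are first given distinct colors by a Borel map `c : X → ℕ`, and the
values of `f` are then chosen one color class after the other by the method of conditional
probabilities. Over the `k` possible values at a point `x`, the conditional probability of violating
a constraint at `x` averages to its current value. Since at most `d` constraints involve `x`, some
value multiplies none of their conditional probabilities by more than `d`. Points of one color share
no constraint, so these choices do not interfere. Once the whole domain of `B` is colored, its
conditional probability is at most `P[B] * d ^ |dom(B)| < 1`, while it would be `1` if `B` were
violated.

The choices are Borel because the points of the constraints in a Borel family of bounded degree form
a Borel set: it is a countable union of bounded-to-one images of Borel sets.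
-/

section MeasurableSets

variable {X : Type*} [MeasurableSpace X]

/-- The points of `S` that are not highest on their vertical line form the projection of a set with
sections of size at most `m - 1`, and the projection is injective on the highest points. -/
theorem measurableSet_image_fst_of_encard_section_le [StandardBorelSpace X] {S : Set (X × ℝ)}
    (hS : MeasurableSet S) {m : ℕ} (hm : ∀ x, {r | (x, r) ∈ S}.encard ≤ m) :
    MeasurableSet (Prod.fst '' S) := by
  induction m generalizing X with
  | zero =>
    have hempty : S = ∅ := Set.eq_empty_of_forall_notMem fun z hz => by
      have hsection := hm z.1
      rw [Nat.cast_zero, nonpos_iff_eq_zero, Set.encard_eq_zero] at hsection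
      exact Set.eq_empty_iff_forall_notMem.mp hsection z.2 hz
    simp only [hempty, Set.image_empty, MeasurableSet.empty]
  | succ m ih =>
    let above : Set ((X × ℝ) × ℝ) := {w | w.1 ∈ S ∧ (w.1.1, w.2) ∈ S ∧ w.1.2 < w.2}
    have habove : MeasurableSet above :=
      (measurable_fst hS).inter <| ((measurable_fst.fst.prodMk measurable_snd) hS).inter <|
        measurableSet_lt measurable_fst.snd measurable_snd
    have hsection (z : X × ℝ) : {r | (z, r) ∈ above}.encard ≤ m := by
      by_cases hz : z ∈ S
      · have hsub : insert z.2 {r | (z, r) ∈ above} ⊆ {r | (z.1, r) ∈ S} :=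
          Set.insert_subset hz fun r hr => hr.2.1
        have hle := (Set.encard_le_encard hsub).trans (hm z.1)
        rw [Set.encard_insert_of_notMem fun hlt => lt_irrefl _ hlt.2.2, Nat.cast_succ] at hle
        exact (ENat.add_le_add_iff_right ENat.one_ne_top).mp hle
      · have hempty : {r | (z, r) ∈ above} = ∅ :=
          Set.eq_empty_of_forall_notMem fun r hr => hz hr.1
        simp only [hempty, Set.encard_empty, zero_le]
    let top : Set (X × ℝ) := S \ Prod.fst '' above
    have htop_injOn : Set.InjOn Prod.fst top := by
      rintro ⟨x, r⟩ ⟨hr, hr_top⟩ ⟨_, r'⟩ ⟨hr', hr'_top⟩ rfl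
      rcases lt_trichotomy r r' with hlt | rfl | hlt
      · exact absurd ⟨(_, r'), ⟨hr, hr', hlt⟩, rfl⟩ hr_top
      · rfl
      · exact absurd ⟨(_, r), ⟨hr', hr, hlt⟩, rfl⟩ hr'_top
    have htop_image : Prod.fst '' top = Prod.fst '' S := by
      refine (Set.image_mono Set.sdiff_subset).antisymm ?_
      rintro _ ⟨⟨x, r⟩, hr, rfl⟩
      obtain ⟨r', hr', hmax⟩ := Set.exists_max_image {r | (x, r) ∈ S} id
        (Set.finite_of_encard_le_coe (hm x)) ⟨r, hr⟩
      refine ⟨(x, r'), ⟨hr', ?_⟩, rfl⟩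
      rintro ⟨w, ⟨-, hw, hlt⟩, hwr'⟩
      rw [hwr'] at hw hlt
      exact (hmax _ hw).not_gt hlt
    rw [← htop_image]
    exact (hS.diff (ih habove hsection)).image_of_measurable_injOn measurable_fst htop_injOn

theorem measurableSet_image_of_encard_fiber_le [StandardBorelSpace X] {Y : Type*}
    [MeasurableSpace Y] [StandardBorelSpace Y] {f : Y → X} (hf : Measurable f) {A : Set Y}
    (hA : MeasurableSet A) {m : ℕ} (hm : ∀ x, (A ∩ f ⁻¹' {x}).encard ≤ m) :
    MeasurableSet (f '' A) := by
  have hemb := MeasureTheory.measurableEmbedding_embeddingReal Y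
  let graphOn : Y → X × ℝ := fun y => (f y, MeasureTheory.embeddingReal Y y)
  have hgraph_inj : Function.Injective graphOn := fun _ _ h => hemb.injective (congrArg Prod.snd h)
  have hgraph : MeasurableSet (graphOn '' A) :=
    hA.image_of_measurable_injOn (hf.prodMk hemb.measurable) hgraph_inj.injOn
  have himage : f '' A = Prod.fst '' (graphOn '' A) := by simp only [Set.image_image, graphOn]
  rw [himage]
  refine measurableSet_image_fst_of_encard_section_le (m := m) hgraph fun x => ?_
  refine (Set.encard_le_encard ?_).trans
    ((Set.encard_image_le (MeasureTheory.embeddingReal Y) _).trans (hm x))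
  rintro r ⟨y, hy, hyr⟩
  exact ⟨y, ⟨hy, congrArg Prod.fst hyr⟩, congrArg Prod.snd hyr⟩

theorem measurableSet_setOf_injective [MeasurableEq X] {ι : Type*} [Countable ι] :
    MeasurableSet {t : ι → X | Function.Injective t} := by
  have hset : {t : ι → X | Function.Injective t} = ⋂ (i) (j) (_ : i ≠ j), {t | t i = t j}ᶜ := by
    ext t
    simp only [Function.Injective, Set.mem_ofPred_eq, Set.mem_iInter, Set.mem_compl_iff]
    exact forall₂_congr fun i j => not_imp_not.symm
  rw [hset]
  exact .iInter fun i => .iInter fun j => .iInter fun _ =>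
    (measurableSet_eq_fun (measurable_pi_apply i) (measurable_pi_apply j)).compl

theorem exists_measurable_forall_mem {β : Type*} [MeasurableSpace β] [Countable β] [Nonempty β]
    {G : β → Set X} (hG : ∀ b, MeasurableSet (G b)) (hcover : ∀ x, ∃ b, x ∈ G b) :
    ∃ g : X → β, Measurable g ∧ ∀ x, x ∈ G (g x) := by
  classical
  obtain ⟨e, he⟩ := exists_surjective_nat β
  have hex (x : X) : ∃ n, x ∈ G (e n) := by
    obtain ⟨b, hb⟩ := hcover x
    obtain ⟨n, rfl⟩ := he b
    exact ⟨n, hb⟩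
  exact ⟨fun x => e (Nat.find (hex x)),
    Measurable.of_discrete.comp (measurable_find hex fun n => hG (e n)),
    fun x => Nat.find_spec (hex x)⟩

theorem exists_measurableSet_seq_isolating [MeasurableSpace.CountablySeparated X] :
    ∃ U : ℕ → Set X, (∀ n, MeasurableSet (U n)) ∧
      ∀ (F : Finset X) (x : X), x ∉ F → ∃ n, x ∈ U n ∧ ∀ y ∈ F, y ∉ U n := by
  obtain ⟨_, _, _, _⟩ := exists_opensMeasurableSpace_of_countablySeparated X
  obtain ⟨b, hb_count, -, hb⟩ := TopologicalSpace.exists_countable_basis X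
  obtain ⟨U, hU⟩ := (hb_count.insert ∅).exists_eq_range (Set.insert_nonempty _ _)
  refine ⟨U, fun n => ?_, fun F x hx => ?_⟩
  · rcases hU ▸ Set.mem_range_self n with hempty | hn
    · exact hempty ▸ MeasurableSet.empty
    · exact (hb.isOpen hn).measurableSet
  · obtain ⟨V, hV, hxV, hVF⟩ := hb.exists_subset_of_mem_open (u := (F : Set X)ᶜ) hx
      F.finite_toSet.isClosed.isOpen_compl
    obtain ⟨n, rfl⟩ : V ∈ Set.range U := hU ▸ Set.mem_insert_of_mem _ hV
    exact ⟨n, hxV, fun y hy hyV => hVF hyV hy⟩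

theorem measurable_univ_image {α : Type*} [DecidableEq α] (m : MeasurableSpace α) {n : ℕ} :
    Measurable[_, finsetBorel α m] fun y : Fin n → α => Finset.univ.image y := by
  intro A hA
  have htuples := MeasurableSpace.map_def.mp (MeasurableSpace.measurableSet_iInf.mp hA n)
  convert htuples

theorem measurable_finset_image {α ι : Type*} [DecidableEq α] (m : MeasurableSpace α)
    (P : Finset ι) {G : ι → X → α} (hG : ∀ i ∈ P, Measurable (G i)) :
    Measurable[_, finsetBorel α m] fun x => P.image fun i => G i x := by
  let e := P.equivFin.symm
  have hfactor : (fun x => P.image fun i => G i x) =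
      fun x => Finset.univ.image fun j => G (e j) x := by
    ext x a
    simp only [Finset.mem_image, Finset.mem_univ, true_and, e.exists_congr_left, e,
      Equiv.symm_symm, Equiv.symm_apply_apply, Subtype.exists, exists_prop]
  rw [hfactor]
  exact (measurable_univ_image m).comp (measurable_pi_lambda _ fun j => hG (e j) (e j).2)

end MeasurableSets

theorem exists_forall_le_card_div_card_mul_sum {ι α : Type*} [Fintype α] [Nonempty α]
    (S : Finset ι) (w : ι → α → ℝ≥0∞) :
    ∃ a, ∀ i ∈ S, w i a ≤ (S.card / Fintype.card α : ℝ≥0∞) * ∑ b, w i b := by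
  have hα : (Fintype.card α : ℝ≥0∞) ≠ 0 := Nat.cast_ne_zero.mpr Fintype.card_ne_zero
  have htotal : ∑ a, ∑ i ∈ S, w i a / ∑ b, w i b ≤ S.card := by
    rw [Finset.sum_comm, Finset.cast_card]
    refine Finset.sum_le_sum fun i _ => ?_
    simp only [div_eq_mul_inv, ← Finset.sum_mul]
    exact ENNReal.div_self_le_one
  obtain ⟨a, ha⟩ : ∃ a, ∑ i ∈ S, w i a / ∑ b, w i b ≤ S.card / Fintype.card α := by
    by_contra! hlt
    refine (ENNReal.sum_lt_sum_of_nonempty Finset.univ_nonempty fun a _ => hlt a).not_ge ?_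
    rwa [Finset.sum_const, Finset.card_univ, nsmul_eq_mul,
      ENNReal.mul_div_cancel hα (ENNReal.natCast_ne_top _)]
  refine ⟨a, fun i hi => ?_⟩
  have hS : (S.card : ℝ≥0∞) ≠ 0 := Nat.cast_ne_zero.mpr (Finset.card_ne_zero_of_mem hi)
  refine (ENNReal.div_le_iff_le_mul ?_ ?_).mp
    ((Finset.single_le_sum (f := fun i => w i a / ∑ b, w i b) (fun _ _ => zero_le) hi).trans ha)
  · exact .inr (ENNReal.div_ne_top (ENNReal.natCast_ne_top _) hα)
  · exact .inr (ENNReal.div_ne_zero.mpr ⟨hS, ENNReal.natCast_ne_top _⟩)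

/-- An injective enumeration of `n` points, used to parametrize the domain of a constraint. -/
abbrev InjTuple (n : ℕ) (X : Type*) := {t : Fin n → X // Function.Injective t}

instance InjTuple.standardBorelSpace {n : ℕ} {X : Type*} [MeasurableSpace X]
    [StandardBorelSpace X] : StandardBorelSpace (InjTuple n X) :=
  measurableSet_setOf_injective.standardBorel

namespace Constraint

variable {X : Type*} {k n : ℕ}

theorem prob_ne_zero (B : Constraint X k) (h : B.patterns.Nonempty) : B.prob ≠ 0 :=
  ENNReal.div_ne_zero.mpr ⟨Nat.cast_ne_zero.mpr (Finset.card_ne_zero.mpr h),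
    ENNReal.pow_ne_top (ENNReal.natCast_ne_top k)⟩

/-- The identification of the indices of an injective tuple with the set of its entries. -/
noncomputable def entriesEquiv (t : InjTuple n X) : Fin n ≃ Finset.univ.map ⟨t.1, t.2⟩ :=
  Equiv.ofBijective (fun i => ⟨t.1 i, Finset.mem_map_of_mem _ (Finset.mem_univ i)⟩)
    ⟨fun _ _ h => t.2 (congrArg Subtype.val h), fun ⟨_, hx⟩ =>
      let ⟨i, _, hi⟩ := Finset.mem_map.mp hx
      ⟨i, Subtype.ext hi⟩⟩

/-- The constraint on the entries of `t` that forbids the patterns `P`, read along `t`. -/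
noncomputable def ofTuple (t : InjTuple n X) (P : Finset (Fin n → Fin k)) : Constraint X k where
  dom := Finset.univ.map ⟨t.1, t.2⟩
  patterns := P.map ((entriesEquiv t).arrowCongr (Equiv.refl (Fin k))).toEmbedding

/-- `entriesEquiv` as an indexing of the domain of `ofTuple t P`. -/
noncomputable def domEquiv (t : InjTuple n X) (P : Finset (Fin n → Fin k)) :
    Fin n ≃ (ofTuple t P).dom :=
  entriesEquiv t

@[simp]
theorem coe_domEquiv (t : InjTuple n X) (P : Finset (Fin n → Fin k)) (i : Fin n) :
    (domEquiv t P i : X) = t.1 i := rfl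

theorem dom_ofTuple (t : InjTuple n X) (P : Finset (Fin n → Fin k)) :
    (ofTuple t P).dom = Finset.univ.map ⟨t.1, t.2⟩ := rfl

theorem patterns_ofTuple (t : InjTuple n X) (P : Finset (Fin n → Fin k)) :
    (ofTuple t P).patterns =
      P.map ((domEquiv t P).arrowCongr (Equiv.refl (Fin k))).toEmbedding := rfl

theorem mem_dom_ofTuple {t : InjTuple n X} {P : Finset (Fin n → Fin k)} {x : X} :
    x ∈ (ofTuple t P).dom ↔ ∃ i, t.1 i = x := by
  simp only [dom_ofTuple, Finset.mem_map, Finset.mem_univ, true_and, Function.Embedding.coeFn_mk]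

theorem card_dom_ofTuple (t : InjTuple n X) (P : Finset (Fin n → Fin k)) :
    (ofTuple t P).dom.card = n := by
  rw [dom_ofTuple, Finset.card_map, Finset.card_fin]

theorem nonempty_patterns_ofTuple {t : InjTuple n X} {P : Finset (Fin n → Fin k)} :
    (ofTuple t P).patterns.Nonempty ↔ P.Nonempty :=
  Finset.map_nonempty

theorem eq_of_dom_eq {B B' : Constraint X k} (hdom : B.dom = B'.dom)
    (hpatterns : ∀ ψ : B'.dom → Fin k,
      ψ ∈ B'.patterns ↔ (fun y : B.dom => ψ ⟨y, hdom ▸ y.2⟩) ∈ B.patterns) :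
    B = B' := by
  obtain ⟨D, S⟩ := B
  obtain ⟨D', S'⟩ := B'
  obtain rfl : D = D' := hdom
  congr
  ext ψ
  exact (hpatterns ψ).symm

theorem exists_ofTuple_eq (B : Constraint X k) :
    ∃ (n : ℕ) (t : InjTuple n X) (P : Finset (Fin n → Fin k)), ofTuple t P = B := by
  let e := B.dom.equivFin.symm
  let t : InjTuple B.dom.card X := ⟨fun i => e i, Subtype.val_injective.comp e.injective⟩
  refine ⟨_, t, B.patterns.map (e.symm.arrowCongr (Equiv.refl (Fin k))).toEmbedding,
    (eq_of_dom_eq ?_ fun ψ => ?_).symm⟩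
  · ext x
    rw [mem_dom_ofTuple]
    exact ⟨fun hx => ⟨e.symm ⟨x, hx⟩, by simp only [t, Equiv.apply_symm_apply]⟩,
      fun ⟨i, hi⟩ => hi ▸ (e i).2⟩
  · rw [patterns_ofTuple, Finset.mem_map_equiv, Finset.mem_map_equiv]
    refine iff_of_eq (congrArg (· ∈ B.patterns) (funext fun y => congrArg ψ (Subtype.ext ?_)))
    change (e (e.symm y) : X) = y
    rw [e.apply_symm_apply]

section Code

theorem mem_graph {D : Finset X} {φ : D → Fin k} {x : X} {a : Fin k} :
    (x, a) ∈ graph φ ↔ ∃ hx : x ∈ D, φ ⟨x, hx⟩ = a := by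
  simp [graph]

theorem subset_of_graph_eq {D D' : Finset X} {φ : D → Fin k} {φ' : D' → Fin k}
    (h : graph φ = graph φ') : D ⊆ D' := fun x hx =>
  (mem_graph.mp (h ▸ mem_graph.mpr ⟨hx, rfl⟩ : (x, φ ⟨x, hx⟩) ∈ graph φ')).1

theorem graph_injective {D : Finset X} :
    Function.Injective (graph : (D → Fin k) → Finset (X × Fin k)) := fun φ φ' h =>
  funext fun x => (mem_graph.mp (h ▸ mem_graph.mpr ⟨x.2, rfl⟩ : ((x : X), φ x) ∈ graph φ')).2.symm

theorem code_injOn : Set.InjOn (code : Constraint X k → _) {B | B.patterns.Nonempty} := by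
  classical
  rintro ⟨D, S⟩ ⟨ψ, hψ⟩ ⟨D', S'⟩ - (hcode : S.image graph = S'.image graph)
  obtain ⟨ψ', -, hgraph⟩ := Finset.mem_image.mp (hcode ▸ Finset.mem_image_of_mem graph hψ)
  obtain rfl : D' = D :=
    (subset_of_graph_eq hgraph).antisymm (subset_of_graph_eq hgraph.symm)
  congr
  exact Finset.image_injective graph_injective hcode

theorem nonempty_code {B : Constraint X k} : B.code.Nonempty ↔ B.patterns.Nonempty := by
  classical
  exact Finset.image_nonempty

open scoped Classical in
theorem code_ofTuple (t : InjTuple n X) (P : Finset (Fin n → Fin k)) :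
    (ofTuple t P).code = P.image fun φ => Finset.univ.image fun i => (t.1 i, φ i) := by
  rw [code, patterns_ofTuple, Finset.map_eq_image, Finset.image_image]
  refine Finset.image_congr fun φ _ => ?_
  simp only [Function.comp_apply, graph]
  rw [← Finset.image_univ_equiv (domEquiv t P), Finset.image_image]
  refine Finset.image_congr fun i _ => ?_
  simp [Equiv.arrowCongr]

end Code

section Borel

variable [MeasurableSpace X]

/-- The Borel structure on constraints: the quotient structure induced by their parametrizations
by injective tuples of points. -/
noncomputable instance measurableSpace : MeasurableSpace (Constraint X k) :=
  ⨅ (n : ℕ) (P : Finset (Fin n → Fin k)),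
    MeasurableSpace.map (fun t : InjTuple n X => ofTuple t P) inferInstance

theorem measurableSet_iff {𝓑 : Set (Constraint X k)} :
    MeasurableSet 𝓑 ↔ ∀ (n : ℕ) (P : Finset (Fin n → Fin k)),
      MeasurableSet {t : InjTuple n X | ofTuple t P ∈ 𝓑} := by
  simp only [MeasurableSpace.measurableSet_iInf, MeasurableSpace.map_def]
  rfl

theorem measurable_iff {β : Type*} {_ : MeasurableSpace β} {F : Constraint X k → β} :
    Measurable F ↔ ∀ (n : ℕ) (P : Finset (Fin n → Fin k)),
      Measurable fun t : InjTuple n X => F (ofTuple t P) :=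
  ⟨fun hF n P _ hs => measurableSet_iff.mp (hF hs) n P,
    fun hF _ hs => measurableSet_iff.mpr fun n P => hF n P hs⟩

theorem measurable_tuple_apply (i : Fin n) : Measurable fun t : InjTuple n X => t.1 i :=
  (measurable_pi_apply i).comp measurable_subtype_coe

theorem measurable_code :
    Measurable[_, finsetBorel (Finset (X × Fin k)) (finsetBorel (X × Fin k) inferInstance)]
      (code : Constraint X k → Finset (Finset (X × Fin k))) := by
  classical
  refine measurable_iff.mpr fun n P => ?_
  simp only [code_ofTuple]
  refine measurable_finset_image _ P fun φ _ => measurable_finset_image _ Finset.univ fun i _ => ?_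
  exact (measurable_tuple_apply i).prodMk measurable_const

theorem measurableSet_nonempty_patterns :
    MeasurableSet {B : Constraint X k | B.patterns.Nonempty} := by
  refine measurableSet_iff.mpr fun n P => ?_
  simp only [Set.mem_ofPred_eq, nonempty_patterns_ofTuple, MeasurableSet.const]

theorem measurableSet_nontrivial_dom_inter {U : Set X} [MeasurableEq X] (hU : MeasurableSet U) :
    MeasurableSet {B : Constraint X k | ((B.dom : Set X) ∩ U).Nontrivial} := by
  refine measurableSet_iff.mpr fun n P => ?_
  have hset : {t : InjTuple n X | (((ofTuple t P).dom : Set X) ∩ U).Nontrivial} =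
      ⋃ (i) (j) (_ : i ≠ j), {t | t.1 i ∈ U} ∩ {t | t.1 j ∈ U} := by
    ext t
    simp only [Set.Nontrivial, Set.mem_inter_iff, Finset.mem_coe, mem_dom_ofTuple,
      Set.mem_ofPred_eq, Set.mem_iUnion]
    constructor
    · rintro ⟨_, ⟨⟨i, rfl⟩, hi⟩, _, ⟨⟨j, rfl⟩, hj⟩, hij⟩
      exact ⟨i, j, ne_of_apply_ne t.1 hij, hi, hj⟩
    · rintro ⟨i, j, hij, hi, hj⟩
      exact ⟨_, ⟨⟨i, rfl⟩, hi⟩, _, ⟨⟨j, rfl⟩, hj⟩, t.2.ne hij⟩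
  exact hset ▸ .iUnion fun i => .iUnion fun j => .iUnion fun _ =>
    (measurable_tuple_apply i hU).inter (measurable_tuple_apply j hU)

end Borel

section ConditionalProbability

variable {B : Constraint X k} {s : Set X} {f f' : X → Fin k} {x : X}

open scoped Classical in
/-- The probability that a uniformly random coloring of the domain of `B`, conditioned to agree
with `f` on `s`, is a pattern of `B`. -/
noncomputable def condProb (B : Constraint X k) (s : Set X) (f : X → Fin k) : ℝ≥0∞ :=
  (B.patterns.filter fun ψ => ∀ y : B.dom, (y : X) ∈ s → ψ y = f y).card /
    (k : ℝ≥0∞) ^ (B.dom.filter fun y => y ∉ s).card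

theorem condProb_empty (B : Constraint X k) (f : X → Fin k) : B.condProb ∅ f = B.prob := by
  simp [condProb, prob]

theorem condProb_congr (B : Constraint X k) {s' : Set X} (hs : ∀ y ∈ B.dom, y ∈ s ↔ y ∈ s')
    (hf : ∀ y ∈ B.dom, y ∈ s → f y = f' y) : B.condProb s f = B.condProb s' f' := by
  classical
  have hpatterns (ψ : B.dom → Fin k) :
      (∀ y : B.dom, (y : X) ∈ s → ψ y = f y) ↔ ∀ y : B.dom, (y : X) ∈ s' → ψ y = f' y :=
    forall_congr' fun y => by
      rw [← hs y y.2]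
      exact forall_congr' fun hy => by rw [hf y y.2 hy]
  have hdom : B.dom.filter (· ∉ s) = B.dom.filter (· ∉ s') :=
    Finset.filter_congr fun y hy => not_congr (hs y hy)
  simp only [condProb, hpatterns, hdom]

theorem Violates.one_le_condProb (h : Violates f B) (hs : ∀ y ∈ B.dom, y ∈ s) :
    1 ≤ B.condProb s f := by
  classical
  have hdom : B.dom.filter (· ∉ s) = ∅ := Finset.filter_eq_empty_iff.mpr fun y hy => by
    simpa only [not_not] using hs y hy
  rw [condProb, hdom, Finset.card_empty, pow_zero, div_one, Nat.one_le_cast]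
  exact Finset.card_pos.mpr ⟨_, Finset.mem_filter.mpr ⟨h, fun _ _ => rfl⟩⟩

theorem sum_condProb_update [DecidableEq X] (hx : x ∈ B.dom) (hxs : x ∉ s) :
    ∑ a, B.condProb (insert x s) (Function.update f x a) = k * B.condProb s f := by
  classical
  generalize hs' : insert x s = s'
  have hmem {y : X} : y ∈ s' ↔ y = x ∨ y ∈ s := hs' ▸ Set.mem_insert_iff
  have hk : k ≠ 0 := fun hk => (hk ▸ f x : Fin 0).elim0
  have hpatterns (a : Fin k) (ψ : B.dom → Fin k) :
      (∀ y : B.dom, (y : X) ∈ s' → ψ y = Function.update f x a y) ↔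
        (∀ y : B.dom, (y : X) ∈ s → ψ y = f y) ∧ ψ ⟨x, hx⟩ = a := by
    have hupdate {y : X} (hy : y ∈ s) : Function.update f x a y = f y :=
      Function.update_of_ne (ne_of_mem_of_not_mem hy hxs) _ _
    constructor
    · exact fun h => ⟨fun y hy => (h y (hmem.mpr (.inr hy))).trans (hupdate hy),
        (h ⟨x, hx⟩ (hmem.mpr (.inl rfl))).trans (Function.update_self _ _ _)⟩
    · rintro ⟨h, hψx⟩ ⟨y, hy⟩ hys'
      rcases hmem.mp hys' with rfl | hys
      · exact by simpa using hψx
      · exact (h ⟨y, hy⟩ hys).trans (hupdate hys).symm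
  have hcard : (B.dom.filter (· ∉ s)).card = (B.dom.filter (· ∉ s')).card + 1 := by
    rw [← Finset.card_insert_of_notMem (a := x) (by simp [hmem])]
    congr 1
    ext y
    by_cases hyx : y = x <;> simp [hmem, hyx, hx, hxs]
  have hcancel (m : ℕ) : (k : ℝ≥0∞) * ((k : ℝ≥0∞) ^ (m + 1))⁻¹ = ((k : ℝ≥0∞) ^ m)⁻¹ := by
    rw [pow_succ', ENNReal.mul_inv (by simp [hk]) (by simp), ← mul_assoc,
      ENNReal.mul_inv_cancel (by simpa using hk) (by simp), one_mul]
  simp only [condProb, hpatterns, ← Finset.filter_filter, div_eq_mul_inv]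
  rw [← Finset.sum_mul, ← Nat.cast_sum, ← Finset.card_eq_sum_card_fiberwise
    fun _ _ => Finset.mem_coe.mpr (Finset.mem_univ _), hcard, mul_left_comm, hcancel]

theorem condProb_union_eq_insert_update [DecidableEq X] {A : Set X}
    (hA : ((B.dom : Set X) ∩ A).Subsingleton) (hx : x ∈ B.dom) (hxA : x ∈ A)
    (hf : ∀ y ∉ A, f' y = f y) :
    B.condProb (s ∪ A) f' = B.condProb (insert x s) (Function.update f x (f' x)) := by
  have hAx {y : X} (hy : y ∈ B.dom) : y ∈ A ↔ y = x :=
    ⟨fun hyA => hA ⟨hy, hyA⟩ ⟨hx, hxA⟩, fun hyx => hyx ▸ hxA⟩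
  refine B.condProb_congr (fun y hy => ?_) fun y hy _ => ?_
  · rw [Set.mem_union, hAx hy, Set.mem_insert_iff, or_comm]
  · rcases eq_or_ne y x with rfl | hyx
    · rw [Function.update_self]
    · rw [Function.update_of_ne hyx, hf y (mt (hAx hy).mp hyx)]

open scoped Classical in
theorem condProb_ofTuple (t : InjTuple n X) (P : Finset (Fin n → Fin k)) :
    (ofTuple t P).condProb s f =
      (P.filter fun φ => ∀ i, t.1 i ∈ s → φ i = f (t.1 i)).card /
        (k : ℝ≥0∞) ^ (Finset.univ.filter fun i => t.1 i ∉ s).card := by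
  refine congrArg₂ (· / ·) (congrArg Nat.cast ?_) (congrArg ((k : ℝ≥0∞) ^ ·) ?_)
  · rw [patterns_ofTuple, Finset.filter_map, Finset.card_map]
    refine congrArg Finset.card (Finset.filter_congr fun φ _ => ?_)
    refine (domEquiv t P).forall_congr_right.symm.trans (forall_congr' fun i => ?_)
    simp [Equiv.arrowCongr]
  · rw [dom_ofTuple, Finset.filter_map, Finset.card_map]
    rfl

theorem measurable_condProb [MeasurableSpace X] (hs : MeasurableSet s) (hf : Measurable f) :
    Measurable fun B : Constraint X k => B.condProb s f := by
  classical
  refine measurable_iff.mpr fun n P => ?_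
  have hvalues : Measurable fun (t : InjTuple n X) i => (t.1 i ∈ s, f (t.1 i)) :=
    measurable_pi_lambda _ fun i => (hs.mem.prodMk hf).comp (measurable_tuple_apply i)
  have hdiscrete : Measurable fun v : Fin n → Prop × Fin k =>
      ((P.filter fun φ => ∀ i, (v i).1 → φ i = (v i).2).card : ℝ≥0∞) /
        (k : ℝ≥0∞) ^ (Finset.univ.filter fun i => ¬ (v i).1).card := .of_discrete
  simpa only [condProb_ofTuple, Function.comp_def] using hdiscrete.comp hvalues

end ConditionalProbability

end Constraint

namespace CSP

variable {X : Type*} {k : ℕ} {𝓑 : CSP X k} {d : ℕ}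

/-- The set of points on which some constraint of `𝓑` depends. -/
def support (𝓑 : CSP X k) : Set X := {x | ∃ B ∈ 𝓑, x ∈ B.dom}

section Degree

theorem vdeg_mono {𝓑' : CSP X k} (h : 𝓑 ⊆ 𝓑') : 𝓑.vdeg ≤ 𝓑'.vdeg :=
  iSup_mono fun _ => Set.encard_le_encard fun _ hB => ⟨h hB.1, hB.2⟩

theorem exists_finset_of_vdeg_le (hd : 𝓑.vdeg ≤ d) (x : X) :
    ∃ S : Finset (Constraint X k), S.card ≤ d ∧ ∀ B, B ∈ S ↔ B ∈ 𝓑 ∧ x ∈ B.dom := by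
  have hx : {B ∈ 𝓑 | x ∈ B.dom}.encard ≤ d :=
    (le_iSup (fun x => {B ∈ 𝓑 | x ∈ B.dom}.encard) x).trans hd
  have hfin := Set.finite_of_encard_le_coe hx
  exact ⟨hfin.toFinset, by rwa [hfin.encard_eq_coe_toFinset_card, Nat.cast_le] at hx,
    fun B => hfin.mem_toFinset⟩

theorem encard_setOf_ofTuple_mem_le (hd : 𝓑.vdeg ≤ d) {n : ℕ} (P : Finset (Fin n → Fin k))
    (i : Fin n) (x : X) :
    {t : InjTuple n X | Constraint.ofTuple t P ∈ 𝓑 ∧ t.1 i = x}.encard ≤ (d * n ^ n : ℕ) := by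
  classical
  obtain ⟨S, hScard, hS⟩ := exists_finset_of_vdeg_le hd x
  let tuples : Finset (Fin n → X) :=
    {B ∈ S | B.dom.card = n}.biUnion fun B => Fintype.piFinset fun _ => B.dom
  have hsub : Subtype.val '' {t : InjTuple n X | Constraint.ofTuple t P ∈ 𝓑 ∧ t.1 i = x} ⊆
      tuples := by
    rintro _ ⟨t, ⟨ht, hti⟩, rfl⟩
    exact Finset.mem_biUnion.mpr ⟨Constraint.ofTuple t P,
      Finset.mem_filter.mpr ⟨(hS _).mpr ⟨ht, Constraint.mem_dom_ofTuple.mpr ⟨i, hti⟩⟩,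
        Constraint.card_dom_ofTuple t P⟩,
      Fintype.mem_piFinset.mpr fun j => Constraint.mem_dom_ofTuple.mpr ⟨j, rfl⟩⟩
  have hcard : tuples.card ≤ d * n ^ n := by
    refine (Finset.card_biUnion_le_card_mul _ _ (n ^ n) fun B hB => ?_).trans
      (Nat.mul_le_mul_right _ ((Finset.card_filter_le _ _).trans hScard))
    rw [Fintype.card_piFinset_const, (Finset.mem_filter.mp hB).2]
  rw [← Subtype.val_injective.encard_image]
  refine (Set.encard_le_encard hsub).trans ?_
  rw [Set.encard_coe_eq_coe_finsetCard]
  exact_mod_cast hcard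

theorem exists_forall_condProb_update_le [DecidableEq X] (hd : 𝓑.vdeg ≤ d) {s : Set X} {x : X}
    (hx : x ∉ s) (f : X → Fin k) :
    ∃ a, ∀ B ∈ 𝓑, x ∈ B.dom →
      B.condProb (insert x s) (Function.update f x a) ≤ d * B.condProb s f := by
  have : Nonempty (Fin k) := ⟨f x⟩
  have hk : (k : ℝ≥0∞) ≠ 0 := Nat.cast_ne_zero.mpr (f x).pos.ne'
  obtain ⟨S, hScard, hS⟩ := exists_finset_of_vdeg_le hd x
  obtain ⟨a, ha⟩ := exists_forall_le_card_div_card_mul_sum S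
    fun B a => B.condProb (insert x s) (Function.update f x a)
  refine ⟨a, fun B hB hxB => (ha B ((hS B).mpr ⟨hB, hxB⟩)).trans ?_⟩
  rw [Constraint.sum_condProb_update hxB hx, Fintype.card_fin, ← mul_assoc,
    ENNReal.div_mul_cancel hk (ENNReal.natCast_ne_top k)]
  gcongr

end Degree

section Borel

variable [MeasurableSpace X] [StandardBorelSpace X]

theorem measurableSet_support (h𝓑 : MeasurableSet 𝓑) (hd : 𝓑.vdeg ≤ d) :
    MeasurableSet 𝓑.support := by
  have hset : 𝓑.support = ⋃ (n) (P : Finset (Fin n → Fin k)) (i : Fin n),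
      (fun t : InjTuple n X => t.1 i) '' {t | Constraint.ofTuple t P ∈ 𝓑} := by
    ext x
    simp only [Set.mem_iUnion]
    constructor
    · rintro ⟨B, hB, hx⟩
      obtain ⟨n, t, P, rfl⟩ := B.exists_ofTuple_eq
      obtain ⟨i, hi⟩ := Constraint.mem_dom_ofTuple.mp hx
      exact ⟨n, P, i, t, hB, hi⟩
    · rintro ⟨n, P, i, t, ht, hi⟩
      exact ⟨_, ht, Constraint.mem_dom_ofTuple.mpr ⟨i, hi⟩⟩
  rw [hset]
  exact .iUnion fun n => .iUnion fun P => .iUnion fun i =>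
    measurableSet_image_of_encard_fiber_le (Constraint.measurable_tuple_apply i)
      (Constraint.measurableSet_iff.mp h𝓑 n P) (encard_setOf_ofTuple_mem_le hd P i)

theorem exists_measurable_injOn_dom (h𝓑 : MeasurableSet 𝓑) (hd : 𝓑.vdeg ≤ d) :
    ∃ c : X → ℕ, Measurable c ∧ ∀ B ∈ 𝓑, Set.InjOn c B.dom := by
  classical
  obtain ⟨U, hU, hisolate⟩ := exists_measurableSet_seq_isolating (X := X)
  -- `x` gets a color `n` such that every domain containing `x` meets `U n` in `x` alone.
  let crowded (n : ℕ) : CSP X k := {B ∈ 𝓑 | ((B.dom : Set X) ∩ U n).Nontrivial}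
  have hcrowded (n : ℕ) : MeasurableSet (crowded n).support :=
    measurableSet_support
      (h𝓑.inter (Constraint.measurableSet_nontrivial_dom_inter (hU n)))
      ((vdeg_mono Set.inter_subset_left).trans hd)
  have hcover (x : X) : ∃ n, x ∈ U n \ (crowded n).support := by
    obtain ⟨S, -, hS⟩ := exists_finset_of_vdeg_le hd x
    obtain ⟨n, hxn, hn⟩ := hisolate ((S.biUnion Constraint.dom).erase x) x
      (Finset.notMem_erase x _)
    refine ⟨n, hxn, fun ⟨B, ⟨hB, hnontrivial⟩, hx⟩ => ?_⟩
    obtain ⟨y, ⟨hy, hyn⟩, hyx⟩ := hnontrivial.exists_ne x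
    exact hn y (Finset.mem_erase.mpr
      ⟨hyx, Finset.mem_biUnion.mpr ⟨B, (hS B).mpr ⟨hB, hx⟩, hy⟩⟩) hyn
  obtain ⟨c, hc, hcU⟩ := exists_measurable_forall_mem (fun n => (hU n).diff (hcrowded n)) hcover
  refine ⟨c, hc, fun B hB x hx y hy hxy => ?_⟩
  by_contra hne
  exact (hcU x).2 ⟨B, ⟨hB, x, ⟨hx, (hcU x).1⟩, y, ⟨hy, hxy ▸ (hcU y).1⟩, hne⟩, hx⟩

theorem exists_measurable_condProb_union_le (h𝓑 : MeasurableSet 𝓑) (hd : 𝓑.vdeg ≤ d)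
    {s A : Set X} (hs : MeasurableSet s) (hA : MeasurableSet A) (hsA : Disjoint s A)
    (hsub : ∀ B ∈ 𝓑, ((B.dom : Set X) ∩ A).Subsingleton) {f : X → Fin k} (hf : Measurable f) :
    ∃ f' : X → Fin k, Measurable f' ∧ (∀ y ∉ A, f' y = f y) ∧
      ∀ B ∈ 𝓑, ∀ x ∈ B.dom, x ∈ A → B.condProb (s ∪ A) f' ≤ d * B.condProb s f := by
  classical
  rcases isEmpty_or_nonempty X with _ | ⟨⟨x₀⟩⟩
  · exact ⟨f, hf, fun _ _ => rfl, fun _ _ x => isEmptyElim x⟩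
  have : Nonempty (Fin k) := ⟨f x₀⟩
  let bad (a : Fin k) : CSP X k :=
    {B ∈ 𝓑 | d * B.condProb s f < B.condProb (s ∪ A) (A.piecewise (fun _ => a) f)}
  have hbad (a : Fin k) : MeasurableSet (bad a).support :=
    measurableSet_support
      (h𝓑.inter (measurableSet_lt ((Constraint.measurable_condProb hs hf).const_mul _)
        (Constraint.measurable_condProb (hs.union hA) (measurable_const.piecewise hA hf))))
      ((vdeg_mono Set.inter_subset_left).trans hd)
  have hupdate {B : Constraint X k} (hB : B ∈ 𝓑) {x : X} (hx : x ∈ B.dom) (hxA : x ∈ A)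
      (g : X → Fin k) : B.condProb (s ∪ A) (A.piecewise g f) =
        B.condProb (insert x s) (Function.update f x (g x)) := by
    rw [Constraint.condProb_union_eq_insert_update (hsub B hB) hx hxA
      fun y hy => A.piecewise_eq_of_notMem _ _ hy, A.piecewise_eq_of_mem _ _ hxA]
  have hcover (x : X) : ∃ a, x ∈ (A ∩ (bad a).support)ᶜ := by
    by_cases hxA : x ∈ A
    · obtain ⟨a, ha⟩ := exists_forall_condProb_update_le hd (hsA.notMem_of_mem_right hxA) f
      refine ⟨a, fun ⟨_, B, ⟨hB, hlt⟩, hx⟩ => hlt.not_ge ?_⟩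
      exact (hupdate hB hx hxA _).trans_le (ha B hB hx)
    · exact ⟨f x, fun h => hxA h.1⟩
  obtain ⟨g, hg, hgood⟩ := exists_measurable_forall_mem (fun a => (hA.inter (hbad a)).compl) hcover
  refine ⟨A.piecewise g f, hg.piecewise hA hf, fun y hy => A.piecewise_eq_of_notMem _ _ hy,
    fun B hB x hx hxA => ?_⟩
  by_contra! hlt
  refine hgood x ⟨hxA, B, ⟨hB, hlt.trans_eq ?_⟩, hx⟩
  rw [hupdate hB hx hxA, hupdate hB hx hxA]

theorem exists_measurable_seq_condProb_le [NeZero k] (h𝓑 : MeasurableSet 𝓑) (hd : 𝓑.vdeg ≤ d)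
    {c : X → ℕ} (hc : Measurable c) (hinj : ∀ B ∈ 𝓑, Set.InjOn c B.dom) :
    ∃ F : ℕ → X → Fin k, (∀ m, Measurable (F m)) ∧ (∀ m y, c y ≠ m → F (m + 1) y = F m y) ∧
      ∀ m, ∀ B ∈ 𝓑, ∀ x ∈ B.dom, c x = m →
        B.condProb {y | c y < m + 1} (F (m + 1)) ≤ d * B.condProb {y | c y < m} (F m) := by
  have hstep (m : ℕ) (f : {f : X → Fin k // Measurable f}) :
      ∃ f' : {f : X → Fin k // Measurable f}, (∀ y, c y ≠ m → f'.1 y = f.1 y) ∧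
        ∀ B ∈ 𝓑, ∀ x ∈ B.dom, c x = m →
          B.condProb {y | c y < m + 1} f'.1 ≤ d * B.condProb {y | c y < m} f.1 := by
    have hunion : {y | c y < m + 1} = {y | c y < m} ∪ {y | c y = m} := by
      ext y
      simp only [Order.lt_add_one_iff, le_iff_lt_or_eq, Set.mem_union, Set.mem_ofPred_eq]
    obtain ⟨f', hf', hagree, hle⟩ := exists_measurable_condProb_union_le h𝓑 hd
      (measurableSet_lt hc measurable_const) (hc (measurableSet_singleton m))
      (Set.disjoint_left.mpr fun y hlt heq => hlt.ne heq)
      (fun B hB x hx y hy => hinj B hB hx.1 hy.1 (hx.2.trans hy.2.symm)) f.2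
    exact ⟨⟨f', hf'⟩, hagree, hunion ▸ hle⟩
  choose next hagree hle using hstep
  let F : ℕ → {f : X → Fin k // Measurable f} :=
    Nat.rec ⟨fun _ => 0, measurable_const⟩ next
  exact ⟨fun m => (F m).1, fun m => (F m).2, fun m => hagree m (F m), fun m => hle m (F m)⟩

end Borel

theorem condProb_le_prob_mul_pow {c : X → ℕ} {F : ℕ → X → Fin k} {B : Constraint X k}
    (hinj : Set.InjOn c B.dom) (hagree : ∀ m y, c y ≠ m → F (m + 1) y = F m y)
    (hle : ∀ m, ∀ x ∈ B.dom, c x = m →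
      B.condProb {y | c y < m + 1} (F (m + 1)) ≤ d * B.condProb {y | c y < m} (F m)) (m : ℕ) :
    B.condProb {y | c y < m} (F m) ≤ B.prob * d ^ (B.dom.filter fun y => c y < m).card := by
  classical
  induction m with
  | zero => simp [Constraint.condProb_empty]
  | succ m ih =>
    by_cases hm : ∃ x ∈ B.dom, c x = m
    · obtain ⟨x, hx, hxm⟩ := hm
      have hfilter : B.dom.filter (fun y => c y < m + 1) =
          insert x (B.dom.filter fun y => c y < m) := by
        ext y
        have hyx : y ∈ B.dom → (c y = m ↔ y = x) := fun hy =>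
          ⟨fun hym => hinj hy hx (hym.trans hxm.symm), fun hyx => hyx ▸ hxm⟩
        grind
      calc B.condProb {y | c y < m + 1} (F (m + 1))
          ≤ d * B.condProb {y | c y < m} (F m) := hle m x hx hxm
        _ ≤ d * (B.prob * d ^ (B.dom.filter fun y => c y < m).card) := by gcongr
        _ = B.prob * d ^ (B.dom.filter fun y => c y < m + 1).card := by
          rw [hfilter, Finset.card_insert_of_notMem (by simp [hxm]), pow_succ', mul_left_comm]
    · push Not at hm
      have hlt (y : X) (hy : y ∈ B.dom) : c y < m + 1 ↔ c y < m := by grind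
      rw [Finset.filter_congr hlt]
      exact (B.condProb_congr hlt fun y hy _ => hagree m y (hm y hy)).trans_le ih

theorem exists_measurable_isSolution [MeasurableSpace X] [StandardBorelSpace X] [NeZero k]
    (h𝓑 : MeasurableSet 𝓑) (hd : 𝓑.vdeg ≤ d) (hlt : ∀ B ∈ 𝓑, B.prob * d ^ B.dom.card < 1) :
    ∃ f : X → Fin k, Measurable f ∧ 𝓑.IsSolution f := by
  obtain ⟨c, hc, hinj⟩ := exists_measurable_injOn_dom h𝓑 hd
  obtain ⟨F, hF, hagree, hle⟩ := exists_measurable_seq_condProb_le h𝓑 hd hc hinj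
  have hstable {y : X} {m : ℕ} (hm : c y + 1 ≤ m) : F m y = F (c y + 1) y := by
    induction m, hm using Nat.le_induction with
    | base => rfl
    | succ m hm ih => rw [hagree m y (Nat.ne_of_lt hm), ih]
  have hlimit : Measurable fun z : ℕ × X => F (z.1 + 1) z.2 :=
    measurable_from_prod_countable_right fun m => hF (m + 1)
  refine ⟨fun y => F (c y + 1) y, hlimit.comp (hc.prodMk measurable_id),
    fun B hB hviolates => (hlt B hB).not_ge ?_⟩
  obtain ⟨m, hm⟩ : ∃ m, ∀ y ∈ B.dom, c y < m :=
    ⟨B.dom.sup c + 1, fun y hy => Nat.lt_succ_of_le (Finset.le_sup hy)⟩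
  calc (1 : ℝ≥0∞)
      ≤ B.condProb {y | c y < m} fun y => F (c y + 1) y := hviolates.one_le_condProb hm
    _ = B.condProb {y | c y < m} (F m) :=
      B.condProb_congr (fun _ _ => Iff.rfl) fun y hy _ => (hstable (hm y hy)).symm
    _ ≤ B.prob * d ^ (B.dom.filter fun y => c y < m).card :=
      condProb_le_prob_mul_pow (hinj B hB) hagree (fun m => hle m B hB) m
    _ = B.prob * d ^ B.dom.card := by rw [Finset.filter_true_of_mem hm]

/-- The constraints of `𝓑` that forbid some pattern, the part of `𝓑` that `IsBorel` controls: all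
other constraints have the same code `∅`. -/
def nontrivialPart (𝓑 : CSP X k) : CSP X k := {B ∈ 𝓑 | B.patterns.Nonempty}

theorem isSolution_nontrivialPart {f : X → Fin k} :
    𝓑.nontrivialPart.IsSolution f ↔ 𝓑.IsSolution f :=
  ⟨fun h B hB hf => h B ⟨hB, _, hf⟩ hf, fun h B hB => h B hB.1⟩

theorem IsBorel.measurableSet_nontrivialPart [MeasurableSpace X] (hB : 𝓑.IsBorel) :
    MeasurableSet 𝓑.nontrivialPart := by
  have hset : 𝓑.nontrivialPart =
      Constraint.code ⁻¹' (Constraint.code '' 𝓑) ∩ {B | B.patterns.Nonempty} := by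
    ext B
    refine ⟨fun hB => ⟨⟨B, hB.1, rfl⟩, hB.2⟩, fun ⟨⟨B', hB', hcode⟩, hB⟩ => ?_⟩
    have hnonempty : B'.patterns.Nonempty :=
      Constraint.nonempty_code.mp (hcode ▸ Constraint.nonempty_code.mpr hB)
    exact ⟨Constraint.code_injOn hnonempty hB hcode ▸ hB', hB⟩
  rw [hset]
  exact (Constraint.measurable_code hB).inter Constraint.measurableSet_nonempty_patterns

theorem vdeg_eq_zero_iff : 𝓑.vdeg = 0 ↔ ∀ B ∈ 𝓑, B.dom = ∅ := by
  simp only [vdeg, ENat.iSup_eq_zero, Set.encard_eq_zero, Set.eq_empty_iff_forall_notMem,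
    Finset.eq_empty_iff_forall_notMem]
  exact ⟨fun h B hB x hx => h x B ⟨hB, hx⟩, fun h x B hB => h B hB.1 x hB.2⟩

theorem prob_mul_vdeg_pow_lt_one (h : 𝓑.p * ((𝓑.vdeg ^ 𝓑.ord : ℕ∞) : ℝ≥0∞) < 1)
    {B : Constraint X k} (hB : B ∈ 𝓑) : B.prob * (𝓑.vdeg : ℝ≥0∞) ^ B.dom.card < 1 := by
  have hcard : (B.dom.card : ℕ∞) ≤ 𝓑.ord := le_iSup₂ (f := fun B _ => (B.dom.card : ℕ∞)) B hB
  have hpow : 𝓑.vdeg ^ B.dom.card ≤ 𝓑.vdeg ^ 𝓑.ord := by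
    rcases eq_or_ne 𝓑.vdeg 0 with hzero | hpos
    · have hord : 𝓑.ord = 0 := by
        simp +contextual [ord, vdeg_eq_zero_iff.mp hzero]
      rw [hord, vdeg_eq_zero_iff.mp hzero B hB, Finset.card_empty, pow_zero, ENat.epow_zero]
    · rw [← ENat.epow_natCast]
      exact ENat.epow_right_mono hpos hcard
  refine lt_of_le_of_lt (mul_le_mul' (le_iSup₂ (f := fun B _ => B.prob) B hB) ?_) h
  rw [← ENat.toENNReal_pow]
  exact ENat.toENNReal_le.mpr hpow

theorem exists_nat_vdeg_nontrivialPart_le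
    (h : ∀ B ∈ 𝓑, B.prob * (𝓑.vdeg : ℝ≥0∞) ^ B.dom.card < 1) :
    ∃ d : ℕ, 𝓑.nontrivialPart.vdeg ≤ d ∧
      ∀ B ∈ 𝓑.nontrivialPart, B.prob * (d : ℝ≥0∞) ^ B.dom.card < 1 := by
  rcases eq_or_ne 𝓑.vdeg ⊤ with htop | hfin
  · have hdom : ∀ B ∈ 𝓑.nontrivialPart, B.dom = ∅ := by
      intro B hB
      by_contra hne
      have hB' := h B hB.1
      rw [htop, ENat.toENNReal_top, ENNReal.top_pow (Finset.card_ne_zero.mpr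
        (Finset.nonempty_iff_ne_empty.mpr hne)), ENNReal.mul_top (B.prob_ne_zero hB.2)] at hB'
      exact not_top_lt hB'
    refine ⟨0, (vdeg_eq_zero_iff.mpr hdom).le, fun B hB => ?_⟩
    simpa only [hdom B hB, Finset.card_empty, pow_zero] using h B hB.1
  · lift 𝓑.vdeg to ℕ using hfin with d hd
    exact ⟨d, (vdeg_mono Set.inter_subset_left).trans hd.ge, fun B hB => h B hB.1⟩

end CSP

theorem corollary1p3_general {X : Type*} [MeasurableSpace X] [StandardBorelSpace X]
    (k : ℕ) (hk : 0 < k) (𝓑 : CSP X k) (hB : 𝓑.IsBorel)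
    (h : ∀ B ∈ 𝓑, B.prob * (𝓑.vdeg : ℝ≥0∞) ^ B.dom.card < 1) :
    ∃ f : X → Fin k, Measurable f ∧ 𝓑.IsSolution f := by
  have : NeZero k := ⟨hk.ne'⟩
  obtain ⟨d, hd, hlt⟩ := CSP.exists_nat_vdeg_nontrivialPart_le h
  obtain ⟨f, hf, hsolution⟩ :=
    CSP.exists_measurable_isSolution hB.measurableSet_nontrivialPart hd hlt
  exact ⟨f, hf, CSP.isSolution_nontrivialPart.mp hsolution⟩

theorem corollary1p3 {X : Type*} [MeasurableSpace X] [StandardBorelSpace X]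
    (k : ℕ) (hk : 0 < k) (𝓑 : CSP X k) (hB : 𝓑.IsBorel)
    (h : 𝓑.p * ((𝓑.vdeg ^ 𝓑.ord : ℕ∞) : ℝ≥0∞) < 1) :
    ∃ f : X → Fin k, Measurable f ∧ 𝓑.IsSolution f :=
  corollary1p3_general k hk 𝓑 hB fun _ hB' => CSP.prob_mul_vdeg_pow_lt_one h hB'
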